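/- Let $p$ be a prime and let $R$ be a regular domain of characteristic $p$ that is $F$-finite (i.e. the Frobenius endomorphism $R\to R$ is finite). For an ideal $\mathfrak{b}$ of a commutative ring $S$ of characteristic $p$ and $q=p^e$ with $e\ge 0$, let $\mathfrak{b}^{[q]}=\langle f^q : f\in\mathfrak{b}\rangle$. For an integer $k\ge 0$ with base $p$ expansion $k=k_0+k_1p+\cdots+k_rp^r$, let $\mathfrak{b}^{[k]}=\prod_{i=0}^{r}\big(\mathfrak{b}^{k_i}\big)^{[p^i]}$. If $S$ is an $F$-finite regular domain, let $\mathfrak{b}^{[1/q]}$ be the smallest ideal $\mathfrak{c}$ of $S$ such that $\mathfrak{b}\subseteq\mathfrak{c}^{[q]}$, and for a real number $t>0$ let \[ \mathfrak{b}^{[t]}=\bigcup_{e\ge 0}\big(\mathfrak{b}^{[\lceil p^e t\rceil]}\big)^{[1/p^e]}, \qquad \tau(\mathfrak{b}^{t})=\bigcup_{e\ge 0}\big(\mathfrak{b}^{\lceil p^e t\rceil}\big)^{[1/p^e]} \] be the $t$-th Frobenius power and the test ideal of $\mathfrak{b}$ with exponent $t$ (both unions are of ascending chains of ideals). For $f\in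 S$, write $\tau(f^t)=\tau(\langle f\rangle^t)$. Theorem (Principalization). Let $\mathfrak{a}=\langle g_1,\dots,g_m\rangle$ be an ideal of $R$, let $z=z_1,\dots,z_m$ be variables over $R$, and let $G=z_1g_1+\cdots+z_mg_m\in R[z]$ be the generic linear combination. If $0<t<1$, then \[ \tau(G^t)=\mathfrak{a}^{[t]}\cdot R[z]\qquad\text{and}\qquad \mathfrak{a}^{[t]}=\tau(G^t)\cap R . \] -/

import Mathlib

open scoped BigOperators

noncomputable section

namespace GenFrob

variable {R : Type*} [CommRing R]

/-- The standard Frobenius power `I^[q]`: the ideal generated by the `q`-th powers of the elements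
of `I` (meant for `q = p ^ e` in a ring of characteristic `p`). -/
def frobPow (q : ℕ) (I : Ideal R) : Ideal R :=
  Ideal.span {x : R | ∃ f ∈ I, x = f ^ q}

/-- The integral Frobenius power `I^[k]`. If `k = k₀ + k₁ p + k₂ p² + ⋯` is the base `p` expansion,
it is the product of the ideals `(I ^ kᵢ)^[p ^ i]`. Here `kᵢ = k / p ^ i % p`, and it suffices to
let `i` run through `0, …, k` since `k < p ^ i` for `i > k`. -/
def intFrobPow (p k : ℕ) (I : Ideal R) : Ideal R :=
  ∏ i ∈ Finset.range (k + 1), frobPow (p ^ i) (I ^ (k / p ^ i % p))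

/-- The Frobenius root `I^[1/q]`: the smallest ideal `J` with `I ≤ J^[q]`. -/
def frobRoot (q : ℕ) (I : Ideal R) : Ideal R :=
  sInf {J : Ideal R | I ≤ frobPow q J}

/-- The rational Frobenius power `I^[k / p ^ e] = (I^[k])^[1 / p ^ e]`. -/
def ratFrobPow (p k e : ℕ) (I : Ideal R) : Ideal R :=
  frobRoot (p ^ e) (intFrobPow p k I)

/-- The real Frobenius power `I^[t]`, `t ≥ 0`: the union of the ascending chain of the ideals
`I^[⌈p ^ e t⌉ / p ^ e]`, whose exponents decrease to `t`. -/
def realFrobPow (p : ℕ) (t : ℝ) (I : Ideal R) : Ideal R :=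
  ⨆ e : ℕ, ratFrobPow p ⌈(p : ℝ) ^ e * t⌉₊ e I

/-- The test ideal `τ(I ^ t)`, `t > 0`: the union of the ascending chain of the ideals
`(I ^ ⌈p ^ e t⌉)^[1 / p ^ e]`, formed with ordinary powers of `I`. -/
def testIdeal (p : ℕ) (t : ℝ) (I : Ideal R) : Ideal R :=
  ⨆ e : ℕ, frobRoot (p ^ e) (I ^ ⌈(p : ℝ) ^ e * t⌉₊)

/-- The generic linear combination `z₁ g₁ + ⋯ + z_m g_m` in `R[z₁, …, z_m]`. -/
def genericCombination {m : ℕ} (g : Fin m → R) : MvPolynomial (Fin m) R :=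
  ∑ i, MvPolynomial.X i * MvPolynomial.C (g i)

end GenFrob

end

/-!
Let `q = p ^ e`, let `𝔞 = (g₁, …, g_m)` and let `G` be the generic linear combination.

For `k ≥ 0` the coefficients of `G ^ k` generate an ideal containing `𝔞^[k]`: if `k < p`, they are
the monomials of degree `k` in the `gᵢ` up to multinomial coefficients that are units modulo `p`,
and in general `G ^ k` is the product of the polynomials `(G ^ kᵢ) ^ p ^ i` over the base `p` digits
`kᵢ`, which do not interfere for degree reasons. Now let `k < q` and `G ^ k ∈ J^[q]`. The monomials
with exponents less than `q` are part of a basis of `R[z]` over the subring of polynomials in the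
`zᵢ ^ q`, so each coefficient of `G ^ k` lies in the extension of `J` along the Frobenius of the
coefficients, hence in `(J ∩ R)^[q]` because this Frobenius is flat. Therefore
`𝔞^[k] ≤ (J ∩ R)^[q]`, which bounds `(𝔞^[k])^[1/q]` by `J`. The other inclusion holds since
`G ^ k ∈ (𝔞 R[z])^[k]`. The levels `e` with `⌈p ^ e t⌉ = p ^ e` do not contribute to `𝔞^[t]`: their
ideals are contained in `𝔞`, which is contained in the ideals of all levels.

Flatness of the Frobenius of a regular local ring (Kunz) holds because the maximal ideal is
generated by a regular sequence, whose `p`-th powers again form a regular sequence: so the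
generators form a regular sequence on the ring as a module over itself via Frobenius, and a finite
module on which generators of the maximal ideal form a regular sequence is free.
-/

namespace GenFrob

universe u

section RegularLocalRing

open IsLocalRing

variable {R : Type u} [CommRing R]

theorem exists_finset_span_insert_eq_maximalIdeal [IsLocalRing R] (hfg : (maximalIdeal R).FG)
    {x : R} (hx : x ∈ maximalIdeal R) (hx2 : x ∉ maximalIdeal R ^ 2) :
    ∃ t : Finset R, t.card + 1 = (maximalIdeal R).spanFinrank ∧
      Ideal.span (insert x (t : Set R)) = maximalIdeal R := by
  classical
  obtain ⟨s, hcard, hs⟩ := Submodule.FG.exists_span_finset_card_eq_spanFinrank hfg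
  have hsm : ∀ y ∈ s, y ∈ maximalIdeal R := fun y hy ↦ hs ▸ Submodule.subset_span hy
  have hxs : x ∈ Submodule.span R (s : Set R) := hs.symm ▸ hx
  obtain ⟨c, -, hc⟩ := Submodule.mem_span_finset.mp hxs
  obtain ⟨y, hy, hunit⟩ : ∃ y ∈ s, IsUnit (c y) := by
    by_contra! h
    refine hx2 (hc ▸ sum_mem fun y hy ↦ ?_)
    rw [pow_two, smul_eq_mul]
    exact Ideal.mul_mem_mul ((mem_maximalIdeal _).mpr (h y hy)) (hsm y hy)
  refine ⟨s.erase y, by rw [Finset.card_erase_add_one hy, hcard], le_antisymm ?_ ?_⟩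
  · rw [Ideal.span_le, Set.insert_subset_iff]
    exact ⟨hx, fun z hz ↦ hsm z (Finset.mem_of_mem_erase hz)⟩
  · have herase : ∀ z ∈ s.erase y, z ∈ Ideal.span (insert x (s.erase y : Set R)) :=
      fun z hz ↦ Ideal.subset_span (Set.mem_insert_of_mem _ hz)
    have hymem : y ∈ Ideal.span (insert x (s.erase y : Set R)) := by
      rw [← Ideal.unit_mul_mem_iff_mem _ hunit, ← smul_eq_mul,
        eq_sub_of_add_eq ((Finset.add_sum_erase _ _ hy).trans hc)]
      exact sub_mem (Ideal.subset_span (Set.mem_insert _ _))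
        (sum_mem fun z hz ↦ Ideal.mul_mem_left _ _ (herase z hz))
    rw [← hs, Submodule.span_le]
    intro z hz
    by_cases hzy : z = y
    · exact hzy ▸ hymem
    · exact herase z (Finset.mem_erase.mpr ⟨hzy, hz⟩)

theorem isLocalRing_quotient_span_singleton [IsLocalRing R] {x : R} (hx : x ∈ maximalIdeal R) :
    IsLocalRing (R ⧸ Ideal.span {x}) :=
  have : Nontrivial (R ⧸ Ideal.span {x}) := by
    rwa [Ideal.Quotient.nontrivial_iff, Ne, Ideal.span_singleton_eq_top]
  .of_surjective' _ Ideal.Quotient.mk_surjective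

theorem spanFinrank_maximalIdeal_quotient_lt [IsLocalRing R] (hfg : (maximalIdeal R).FG)
    {x : R} (hx : x ∈ maximalIdeal R) (hx2 : x ∉ maximalIdeal R ^ 2)
    [IsLocalRing (R ⧸ Ideal.span {x})] :
    (maximalIdeal (R ⧸ Ideal.span {x})).spanFinrank < (maximalIdeal R).spanFinrank := by
  obtain ⟨t, hcard, ht⟩ := exists_finset_span_insert_eq_maximalIdeal hfg hx hx2
  let mk := Ideal.Quotient.mk (Ideal.span {x})
  have hmk : mk x = 0 := Ideal.Quotient.eq_zero_iff_mem.mpr (Ideal.mem_span_singleton_self x)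
  have hmap : maximalIdeal (R ⧸ Ideal.span {x}) = Ideal.span (mk '' t) := by
    rw [← map_maximalIdeal_of_surjective mk Ideal.Quotient.mk_surjective, ← ht, Ideal.map_span,
      Set.image_insert_eq, hmk, Ideal.span_insert_zero]
  rw [hmap, ← hcard, Nat.lt_succ_iff]
  calc _ ≤ (mk '' t).ncard :=
        Submodule.spanFinrank_span_le_ncard_of_finite (t.finite_toSet.image _)
    _ ≤ t.card := (Set.ncard_image_le t.finite_toSet).trans_eq (Set.ncard_coe_finset t)

theorem isRegularLocalRing_quotient_span_singleton [IsRegularLocalRing R] {x : R}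
    (hx : x ∈ maximalIdeal R) (hx2 : x ∉ maximalIdeal R ^ 2) :
    IsRegularLocalRing (R ⧸ Ideal.span {x}) := by
  have := isLocalRing_quotient_span_singleton hx
  refine IsRegularLocalRing.of_spanFinrank_maximalIdeal_le _
    (ENat.WithBot.add_le_add_one_right_iff.mp ?_)
  calc ((maximalIdeal (R ⧸ Ideal.span {x})).spanFinrank : WithBot ℕ∞) + 1
    _ ≤ (maximalIdeal R).spanFinrank := by
        exact_mod_cast spanFinrank_maximalIdeal_quotient_lt
          (maximalIdeal R).fg_of_isNoetherianRing hx hx2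
    _ = ringKrullDim R := (isRegularLocalRing_iff R).mp ‹_›
    _ ≤ ringKrullDim (R ⧸ Ideal.span {x}) + 1 := by
        have hjac : (({x} : Finset R) : Set R) ⊆ Ring.jacobson R := by
          rwa [ringJacobson_eq_maximalIdeal, Finset.coe_singleton, Set.singleton_subset_iff]
        have hle := ringKrullDim_le_ringKrullDim_quotient_add_card {x} hjac
        rwa [Finset.coe_singleton, Finset.card_singleton, Nat.cast_one] at hle

theorem regularLocalRing_induction
    {P : ∀ (R : Type u) [CommRing R] [IsRegularLocalRing R], Prop}
    (isField : ∀ (R : Type u) [CommRing R] [IsRegularLocalRing R], IsField R → P R)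
    (quotient : ∀ (R : Type u) [CommRing R] [IsRegularLocalRing R], ¬IsField R →
      (∀ x ∈ maximalIdeal R, x ∉ maximalIdeal R ^ 2 →
        ∃ _ : IsRegularLocalRing (R ⧸ Ideal.span {x}), P (R ⧸ Ideal.span {x})) → P R)
    (R : Type u) [CommRing R] [IsRegularLocalRing R] : P R := by
  generalize hn : (maximalIdeal R).spanFinrank = n
  induction n using Nat.strong_induction_on generalizing R with
  | _ n ih =>
    by_cases hR : IsField R
    · exact isField R hR
    refine quotient R hR fun x hx hx2 ↦ ?_
    have := isRegularLocalRing_quotient_span_singleton hx hx2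
    exact ⟨this, ih _ (hn ▸ spanFinrank_maximalIdeal_quotient_lt
      (maximalIdeal R).fg_of_isNoetherianRing hx hx2) _ rfl⟩

theorem maximalIdeal_not_le_sq [IsLocalRing R] (hfg : (maximalIdeal R).FG) (hR : ¬IsField R) :
    ¬maximalIdeal R ≤ maximalIdeal R ^ 2 := fun hle ↦
  hR <| isField_iff_maximalIdeal_eq.mpr <| Submodule.eq_bot_of_le_smul_of_le_jacobson_bot _ _ hfg
    (by rwa [smul_eq_mul, ← pow_two]) (maximalIdeal_le_jacobson _)

theorem maximalIdeal_notMem_minimalPrimes [IsRegularLocalRing R] (hR : ¬IsField R) :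
    maximalIdeal R ∉ minimalPrimes R := fun hmin ↦ by
  have hdim := (isRegularLocalRing_iff R).mp ‹_›
  rw [← maximalIdeal_height_eq_ringKrullDim, Ideal.height_eq_zero_iff.mpr hmin] at hdim
  exact hR <| isField_iff_maximalIdeal_eq.mpr <|
    (Submodule.spanFinrank_eq_zero_iff_eq_bot (maximalIdeal R).fg_of_isNoetherianRing).mp
      (by exact_mod_cast hdim)

theorem exists_mem_maximalIdeal_notMem_sq_notMem_minimalPrimes [IsRegularLocalRing R]
    (hR : ¬IsField R) :
    ∃ x ∈ maximalIdeal R, x ∉ maximalIdeal R ^ 2 ∧ ∀ q ∈ minimalPrimes R, x ∉ q := by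
  classical
  have hfin := minimalPrimes.finite_of_isNoetherianRing R
  by_contra! h
  have hsub : (maximalIdeal R : Set R) ⊆
      ⋃ I ∈ (↑(insert (maximalIdeal R ^ 2) hfin.toFinset) : Set (Ideal R)), (id I : Ideal R) := by
    intro x hx
    simp only [id, Finset.coe_insert, Set.Finite.coe_toFinset, Set.biUnion_insert,
      Set.mem_union, Set.mem_iUnion₂]
    by_cases hx2 : x ∈ maximalIdeal R ^ 2
    · exact Or.inl hx2
    · obtain ⟨q, hq, hxq⟩ := h x hx hx2
      exact Or.inr ⟨q, hq, hxq⟩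
  rw [Ideal.subset_union_prime (maximalIdeal R ^ 2) (maximalIdeal R ^ 2)] at hsub
  · obtain ⟨I, hI, hle⟩ := hsub
    rw [Finset.mem_insert, Set.Finite.mem_toFinset] at hI
    obtain rfl | hI := hI
    · exact maximalIdeal_not_le_sq (maximalIdeal R).fg_of_isNoetherianRing hR hle
    · exact maximalIdeal_notMem_minimalPrimes hR ((le_maximalIdeal hI.1.1.ne_top).antisymm hle ▸ hI)
  · intro I hI hne _
    rw [Finset.mem_insert, Set.Finite.mem_toFinset] at hI
    exact (hI.resolve_left hne).1.1

theorem eq_bot_of_le_span_singleton [IsLocalRing R] {x : R} (hx : x ∈ maximalIdeal R)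
    {q : Ideal R} [q.IsPrime] (hfg : q.FG) (hle : q ≤ Ideal.span {x}) (hxq : x ∉ q) : q = ⊥ := by
  refine Submodule.eq_bot_of_le_smul_of_le_jacobson_bot (Ideal.span {x}) q hfg (fun y hy ↦ ?_)
    (((Ideal.span_singleton_le_iff_mem _).mpr hx).trans (maximalIdeal_le_jacobson _))
  obtain ⟨z, rfl⟩ := Ideal.mem_span_singleton.mp (hle hy)
  exact Ideal.mul_mem_mul (Ideal.mem_span_singleton_self x)
    ((‹q.IsPrime›.mem_or_mem hy).resolve_left hxq)

theorem isDomain_of_isRegularLocalRing (R : Type u) [CommRing R] [IsRegularLocalRing R] :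
    IsDomain R := by
  refine regularLocalRing_induction (P := fun R _ _ ↦ IsDomain R) (fun R _ _ hR ↦ hR.isDomain)
    (fun R _ _ hR ih ↦ ?_) R
  obtain ⟨x, hx, hx2, hxq⟩ := exists_mem_maximalIdeal_notMem_sq_notMem_minimalPrimes hR
  obtain ⟨_, hdom⟩ := ih x hx hx2
  have hprime : (Ideal.span {x}).IsPrime := (Ideal.Quotient.isDomain_iff_prime _).mp hdom
  obtain ⟨q, hq, hqx⟩ := Ideal.exists_minimalPrimes_le (bot_le : ⊥ ≤ Ideal.span {x})
  have hqp : q.IsPrime := hq.1.1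
  have hbot := eq_bot_of_le_span_singleton hx q.fg_of_isNoetherianRing hqx (hxq q hq)
  exact IsDomain.of_bot_isPrime R (hbp := hbot ▸ hqp)

end RegularLocalRing

section RegularSequence

open IsLocalRing RingTheory.Sequence
open scoped Pointwise

variable {R : Type u} [CommRing R]

theorem isWeaklyRegular_self_cons {x : R} {rs : List R} (hx : IsSMulRegular R x)
    (hrs : IsWeaklyRegular (R ⧸ Ideal.span {x}) (rs.map (Ideal.Quotient.mk (Ideal.span {x})))) :
    IsWeaklyRegular R (x :: rs) := by
  refine .cons hx (((Submodule.quotEquivOfEq _ _ ?_).isWeaklyRegular_congr rs).mpr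
    ((isWeaklyRegular_map_algebraMap_iff (R ⧸ Ideal.span {x}) _ rs).mp hrs))
  rw [← Submodule.ideal_span_singleton_smul, smul_eq_mul, Ideal.mul_top]

theorem ofList_cons_eq_of_map_mk_eq {x : R} {rs : List R} {I : Ideal R} (hx : x ∈ I)
    (h : Ideal.ofList (rs.map (Ideal.Quotient.mk (Ideal.span {x}))) =
      I.map (Ideal.Quotient.mk (Ideal.span {x}))) :
    Ideal.ofList (x :: rs) = I := by
  have hle : Ideal.span {x} ≤ I := (Ideal.span_singleton_le_iff_mem _).mpr hx
  have hcomap := congrArg (Ideal.comap (Ideal.Quotient.mk (Ideal.span {x}))) h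
  rw [← Ideal.map_ofList, Ideal.comap_map_of_surjective' _ Ideal.Quotient.mk_surjective,
    Ideal.comap_map_of_surjective' _ Ideal.Quotient.mk_surjective, Ideal.mk_ker,
    sup_eq_left.mpr hle] at hcomap
  rw [Ideal.ofList_cons, sup_comm, hcomap]

theorem exists_isWeaklyRegular_ofList_eq_maximalIdeal (R : Type u) [CommRing R]
    [IsRegularLocalRing R] :
    ∃ rs : List R, Ideal.ofList rs = maximalIdeal R ∧ IsWeaklyRegular R rs := by
  refine regularLocalRing_induction
    (P := fun R _ _ ↦ ∃ rs : List R, Ideal.ofList rs = maximalIdeal R ∧ IsWeaklyRegular R rs)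
    (fun R _ _ hR ↦ ⟨[], ?_, .nil R R⟩) (fun R _ _ hR ih ↦ ?_) R
  · rw [Ideal.ofList_nil, isField_iff_maximalIdeal_eq.mp hR]
  have := isDomain_of_isRegularLocalRing R
  obtain ⟨x, hx, hx2⟩ := SetLike.not_le_iff_exists.mp
    (maximalIdeal_not_le_sq (maximalIdeal R).fg_of_isNoetherianRing hR)
  obtain ⟨_, ss, hss, hreg⟩ := ih x hx hx2
  obtain ⟨rs, rfl⟩ := (Ideal.Quotient.mk_surjective (I := Ideal.span {x})).list_map ss
  refine ⟨x :: rs, ofList_cons_eq_of_map_mk_eq hx ?_,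
    isWeaklyRegular_self_cons (IsSMulRegular.of_ne_zero fun h ↦ hx2 (h ▸ zero_mem _)) hreg⟩
  rw [hss, map_maximalIdeal_of_surjective _ Ideal.Quotient.mk_surjective]

section Module

variable {M : Type*} [AddCommGroup M] [Module R M]

theorem isWeaklyRegular_concat_pow {rs : List R} {x : R} (h : IsWeaklyRegular M (rs ++ [x]))
    (n : ℕ) : IsWeaklyRegular M (rs ++ [x ^ n]) := by
  rw [isWeaklyRegular_append_iff, isWeaklyRegular_singleton_iff] at h ⊢
  exact ⟨h.1, h.2.pow n⟩

-- In a Noetherian local ring a regular sequence may be permuted, so it is enough to know that its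
-- last term may be replaced by a power.
theorem isWeaklyRegular_map_pow_append [IsLocalRing R] [IsNoetherian R M] {rs ss : List R}
    (h : IsWeaklyRegular M (rs ++ ss)) (hmem : ∀ r ∈ rs ++ ss, r ∈ maximalIdeal R) {n : ℕ}
    (hn : n ≠ 0) : IsWeaklyRegular M (rs.map (· ^ n) ++ ss) := by
  induction rs generalizing ss with
  | nil => exact h
  | cons x rs ih =>
    have hlast : IsWeaklyRegular M (rs ++ (ss ++ [x])) := by
      rw [← List.append_assoc]
      exact isWeaklyRegular_of_perm_of_subset_maximalIdeal h (List.perm_append_singleton x _).symm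
        hmem
    have hpow : IsWeaklyRegular M (rs.map (· ^ n) ++ ss ++ [x ^ n]) := by
      refine isWeaklyRegular_concat_pow ?_ n
      rw [List.append_assoc]
      exact ih hlast (by grind)
    have hpowmem : ∀ r ∈ maximalIdeal R, r ^ n ∈ maximalIdeal R :=
      fun r hr ↦ Ideal.pow_mem_of_mem _ hr n (Nat.pos_of_ne_zero hn)
    exact isWeaklyRegular_of_perm_of_subset_maximalIdeal hpow (List.perm_append_singleton _ _)
      (by grind)

theorem isWeaklyRegular_map_pow [IsLocalRing R] [IsNoetherian R M] {rs : List R}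
    (h : IsWeaklyRegular M rs) (hmem : ∀ r ∈ rs, r ∈ maximalIdeal R) {n : ℕ} (hn : n ≠ 0) :
    IsWeaklyRegular M (rs.map (· ^ n)) := by
  simpa using isWeaklyRegular_map_pow_append (ss := []) (by simpa using h) (by simpa using hmem) hn

end Module

theorem free_of_isWeaklyRegular_of_ofList_eq_maximalIdeal {R M : Type*} [CommRing R]
    [AddCommGroup M] [Module R M] [IsLocalRing R] [IsNoetherianRing R] [Module.Finite R M]
    {rs : List R} (h : IsWeaklyRegular M rs)
    (hrs : Ideal.ofList rs = maximalIdeal R) : Module.Free R M := by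
  revert ‹IsLocalRing R› ‹IsNoetherianRing R› ‹Module.Finite R M›
  refine IsWeaklyRegular.ndrecWithRing (motive := fun R _ M _ _ rs ↦ ∀ [IsLocalRing R]
    [IsNoetherianRing R] [Module.Finite R M], Ideal.ofList rs = maximalIdeal R → Module.Free R M)
    (fun R _ M _ _ _ _ _ hrs ↦ ?_) (fun {R} _ {M} _ _ x rs hx _ ih _ _ _ hrs ↦ ?_) h
  · let := (isField_iff_maximalIdeal_eq.mpr (hrs.symm.trans Ideal.ofList_nil)).toField
    exact Module.Free.of_divisionRing R M
  · have hxm : x ∈ maximalIdeal R := hrs ▸ Ideal.subset_span (by simp)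
    have := isLocalRing_quotient_span_singleton hxm
    have := Module.finitePresentation_of_finite R M
    have := Module.Finite.of_restrictScalars_finite R (R ⧸ Ideal.span {x}) (QuotSMulTop x M)
    refine (Module.free_quotSMulTop_iff_free R M (maximalIdeal_le_jacobson ⊥ hxm) hx).mp (ih ?_)
    rw [← Ideal.map_ofList, ← map_maximalIdeal_of_surjective _ Ideal.Quotient.mk_surjective, ← hrs,
      Ideal.ofList_cons, Ideal.map_sup, Ideal.map_quotient_self, bot_sup_eq]

theorem flat_of_isWeaklyRegular_map {R S : Type*} [CommRing R] [CommRing S] [IsLocalRing R]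
    [IsNoetherianRing R] {f : R →+* S} (hf : f.Finite) {rs : List R}
    (hrs : Ideal.ofList rs = maximalIdeal R) (hreg : IsWeaklyRegular S (rs.map f)) : f.Flat := by
  algebraize [f]
  have := free_of_isWeaklyRegular_of_ofList_eq_maximalIdeal
    ((isWeaklyRegular_map_algebraMap_iff S S rs).mp hreg) hrs
  exact Module.Flat.of_free (R := R) (M := S)

theorem frobenius_flat_of_isRegularLocalRing (R : Type u) [CommRing R] [IsRegularLocalRing R]
    (p : ℕ) [Fact p.Prime] [CharP R p] (hF : (frobenius R p).Finite) : (frobenius R p).Flat := by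
  obtain ⟨rs, hrs, hreg⟩ := exists_isWeaklyRegular_ofList_eq_maximalIdeal R
  refine flat_of_isWeaklyRegular_map hF hrs (isWeaklyRegular_map_pow hreg (fun r hr ↦ ?_)
    (Fact.out : p.Prime).ne_zero)
  exact hrs ▸ Ideal.subset_span hr

end RegularSequence

section Frobenius

theorem frobenius_finite_of_isLocalization {R S : Type u} [CommRing R] [CommRing S] [Algebra R S]
    (M : Submonoid R) [IsLocalization M S] (p : ℕ) [ExpChar R p] [ExpChar S p]
    (hF : (frobenius R p).Finite) : (frobenius S p).Finite := by
  have hle : M.map (frobenius R p) ≤ M := by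
    rintro _ ⟨s, hs, rfl⟩
    exact pow_mem hs p
  have : IsLocalization (M.map (frobenius R p)) S :=
    (IsLocalization.iff_of_le_of_exists_dvd _ M hle fun s hs ↦
      ⟨s ^ p, ⟨s, hs, rfl⟩, dvd_pow_self s (expChar_ne_zero R p)⟩).mpr ‹_›
  have hmap : IsLocalization.map S (frobenius R p) (Submonoid.le_comap_map M) = frobenius S p :=
    IsLocalization.map_unique (Submonoid.le_comap_map M) _ fun x ↦
      (RingHom.map_frobenius (algebraMap R S) p x).symm
  exact hmap ▸ RingHom.finite_localizationPreserves (frobenius R p) M S S hF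

theorem frobenius_flat_of_isRegularRing (R : Type u) [CommRing R] [IsRegularRing R] (p : ℕ)
    [Fact p.Prime] [CharP R p] (hF : (frobenius R p).Finite) : (frobenius R p).Flat := by
  refine RingHom.Flat.ofLocalizationPrime _ fun Q hQ ↦ ?_
  have : CharP (Localization.AtPrime Q) p := (CharP.charP_iff_prime_eq_zero Fact.out).mpr (by
    rw [← map_natCast (algebraMap R _), CharP.cast_eq_zero, map_zero])
  have hcomap : Q.comap (frobenius R p) = Q :=
    Ideal.ext fun a ↦ hQ.pow_mem_iff_mem p (Fact.out : p.Prime).pos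
  have hflat := frobenius_flat_of_isRegularLocalRing (Localization.AtPrime Q) p
    (frobenius_finite_of_isLocalization Q.primeCompl p hF)
  have hlocal : ∀ (P : Ideal R) [P.IsPrime] (hP : P = Q.comap (frobenius R p)),
      (Localization.localRingHom P Q (frobenius R p) hP).Flat := by
    intro P _ hP
    obtain rfl := hP.trans hcomap
    rwa [Localization.localRingHom_unique P P (frobenius R p) hP (j := frobenius _ p) fun a ↦
      (RingHom.map_frobenius _ p a).symm]
  exact hlocal _ rfl

theorem iterateFrobenius_flat {R : Type*} [CommRing R] {p : ℕ} [ExpChar R p]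
    (h : (frobenius R p).Flat) (e : ℕ) : (iterateFrobenius R p e).Flat := by
  induction e with
  | zero => exact iterateFrobenius_zero R p ▸ RingHom.Flat.id R
  | succ e ih => exact iterateFrobenius_add R p e 1 ▸ iterateFrobenius_one R p ▸ h.comp ih

end Frobenius

section FlatContraction

open TensorProduct

theorem mem_map_ker_of_tmul_one_eq_zero {R S Q : Type*} [CommRing R] [CommRing S] [CommRing Q]
    [Algebra R S] [Algebra R Q] [Module.Flat R S] {s : S} (hs : s ⊗ₜ[R] (1 : Q) = 0) :
    s ∈ (RingHom.ker (algebraMap R Q)).map (algebraMap R S) := by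
  have hker : s ⊗ₜ[R] (1 : R) ∈ LinearMap.ker ((Algebra.linearMap R Q).lTensor S) := by
    rw [LinearMap.mem_ker, LinearMap.lTensor_tmul, Algebra.linearMap_apply, map_one, hs]
  obtain ⟨x, hx⟩ := (Module.Flat.ker_lTensor_eq (S := R) S (Algebra.linearMap R Q)).le hker
  have hs' : s = TensorProduct.rid R S
      ((LinearMap.ker (Algebra.linearMap R Q)).subtype.lTensor S x) := by
    rw [← one_smul R s, ← TensorProduct.rid_tmul]
    exact congrArg (TensorProduct.rid R S) hx.symm
  rw [hs']
  clear hs hs' hker hx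
  induction x with
  | zero => simp only [map_zero, zero_mem]
  | add x y hx hy => simpa only [map_add] using add_mem hx hy
  | tmul y r =>
    rw [LinearMap.lTensor_tmul, TensorProduct.rid_tmul, Algebra.smul_def]
    exact Ideal.mul_mem_right _ _ (Ideal.mem_map_of_mem _ r.2)

theorem comap_map_le_map_comap_of_isPushout {R S A B : Type*} [CommRing R] [CommRing S] [CommRing A]
    [CommRing B] [Algebra R S] [Algebra R A] [Algebra R B] [Algebra S B] [Algebra A B]
    [IsScalarTower R S B] [IsScalarTower R A B] [Algebra.IsPushout R S A B] [Module.Flat R S]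
    (J : Ideal A) :
    (J.map (algebraMap A B)).comap (algebraMap S B) ≤
      (J.comap (algebraMap R A)).map (algebraMap R S) := by
  let φ : B →ₐ[S] S ⊗[R] (A ⧸ J) :=
    (Algebra.TensorProduct.map (AlgHom.id S S) (Ideal.Quotient.mkₐ R J)).comp
      (Algebra.IsPushout.equiv R S A B).symm.toAlgHom
  have hφ : J.map (algebraMap A B) ≤ RingHom.ker φ := by
    refine Ideal.map_le_iff_le_comap.mpr fun a ha ↦ ?_
    change Algebra.TensorProduct.map _ _
      ((Algebra.IsPushout.equiv R S A B).symm (algebraMap A B a)) = 0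
    rw [Algebra.IsPushout.equiv_symm_algebraMap_right, Algebra.TensorProduct.map_tmul,
      Ideal.Quotient.mkₐ_eq_mk, Ideal.Quotient.eq_zero_iff_mem.mpr ha, tmul_zero]
  intro s hs
  have hs0 : s ⊗ₜ[R] (1 : A ⧸ J) = 0 := (φ.commutes s).symm.trans (hφ hs)
  have hker : RingHom.ker (algebraMap R (A ⧸ J)) = J.comap (algebraMap R A) := by
    rw [← Ideal.Quotient.mk_comp_algebraMap, ← RingHom.comap_ker, Ideal.mk_ker]
  exact hker ▸ mem_map_ker_of_tmul_one_eq_zero hs0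

attribute [local instance] MvPolynomial.algebraMvPolynomial in
theorem comap_C_map_map_le_of_flat {R S σ : Type*} [CommRing R] [CommRing S] {f : R →+* S}
    (hf : f.Flat) (J : Ideal (MvPolynomial σ R)) :
    (J.map (MvPolynomial.map f)).comap MvPolynomial.C ≤ (J.comap MvPolynomial.C).map f := by
  algebraize [f]
  exact comap_map_le_map_comap_of_isPushout (S := S) (B := MvPolynomial σ S) J

theorem le_of_map_le_map_of_faithfullyFlat {R S : Type*} [CommRing R] [CommRing S]
    {f : R →+* S} (hf : f.FaithfullyFlat) {I J : Ideal R} (h : I.map f ≤ J.map f) : I ≤ J := by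
  algebraize_only [f]
  have : Module.FaithfullyFlat R S := hf
  calc I ≤ (J.map f).comap f := Ideal.map_le_iff_le_comap.mp h
    _ = J := Ideal.comap_map_eq_self_of_faithfullyFlat (B := S) J

end FlatContraction

section ResiduePart

open MvPolynomial

variable {R σ : Type*} [CommRing R]

theorem injective_add_smul (q : ℕ) [NeZero q] (u : σ →₀ ℕ) :
    Function.Injective fun v : σ →₀ ℕ ↦ u + q • v :=
  (add_right_injective u).comp (nsmul_right_injective (NeZero.ne q))

/-- The polynomial whose coefficient at `v` is the coefficient of `f` at `u + q v`. If all entries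
of `u` are less than `q`, it is the coordinate of `f` at the element `z ^ u` of the basis of the
polynomial ring over its subring of polynomials in the `q`-th powers of the variables. -/
noncomputable def residuePart (q : ℕ) [NeZero q] (u : σ →₀ ℕ) :
    MvPolynomial σ R →ₗ[R] MvPolynomial σ R where
  toFun := AddMonoidAlgebra.comapDomain (fun v ↦ u + q • v) (injective_add_smul q u)
  map_add' := AddMonoidAlgebra.comapDomain_add _ _
  map_smul' r f := by ext; simp [coeff]

theorem coeff_residuePart (q : ℕ) [NeZero q] (u v : σ →₀ ℕ) (f : MvPolynomial σ R) :
    coeff v (residuePart q u f) = coeff (u + q • v) f := by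
  simp [residuePart, coeff]

theorem smul_le_add_smul_iff {q : ℕ} {u : σ →₀ ℕ} (hu : ∀ i, u i < q) {v w : σ →₀ ℕ} :
    q • v ≤ u + q • w ↔ v ≤ w := by
  refine forall_congr' fun i ↦ ?_
  have hq : 0 < q := (Nat.zero_le _).trans_lt (hu i)
  rw [Finsupp.add_apply, Finsupp.smul_apply, Finsupp.smul_apply, smul_eq_mul, smul_eq_mul,
    mul_comm, ← Nat.le_div_iff_mul_le hq, Nat.add_mul_div_left _ _ hq, Nat.div_eq_of_lt (hu i),
    zero_add]

theorem residuePart_expand_mul {q : ℕ} [NeZero q] {u : σ →₀ ℕ} (hu : ∀ i, u i < q)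
    (h f : MvPolynomial σ R) : residuePart q u (expand q h * f) = h * residuePart q u f := by
  classical
  induction h using induction_on' with
  | monomial v b =>
    ext w
    rw [coeff_residuePart, expand_monomial, coeff_monomial_mul', coeff_monomial_mul']
    simp only [smul_le_add_smul_iff hu]
    split_ifs with hvw
    · obtain ⟨d, rfl⟩ := exists_add_of_le hvw
      rw [smul_add, add_left_comm, add_tsub_cancel_left, add_tsub_cancel_left, coeff_residuePart]
    · rfl
  | add h₁ h₂ ih₁ ih₂ => rw [map_add, add_mul, map_add, ih₁, ih₂, add_mul]

theorem lt_of_coeff_ne_zero {q : ℕ} {f : MvPolynomial σ R} (hf : ∀ i, f.degreeOf i < q)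
    {u : σ →₀ ℕ} (hu : coeff u f ≠ 0) (i : σ) : u i < q :=
  (monomial_le_degreeOf i (mem_support_iff.mpr hu)).trans_lt (hf i)

theorem residuePart_eq_C {q : ℕ} [NeZero q] {f : MvPolynomial σ R} (hf : ∀ i, f.degreeOf i < q)
    (u : σ →₀ ℕ) : residuePart q u f = C (coeff u f) := by
  classical
  ext v
  rw [coeff_residuePart, coeff_C]
  split_ifs with hv
  · rw [← hv, smul_zero, add_zero]
  · by_contra h
    obtain ⟨i, hi⟩ := Finsupp.ne_iff.mp (Ne.symm hv)
    have hlt : u i + q * v i < q := lt_of_coeff_ne_zero hf h i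
    have hle : q ≤ q * v i := Nat.le_mul_of_pos_right q (Nat.pos_of_ne_zero hi)
    omega

theorem C_coeff_mem_of_mem_map_expand {q : ℕ} [NeZero q] {K : Ideal (MvPolynomial σ R)}
    {h : MvPolynomial σ R} (hdeg : ∀ i, h.degreeOf i < q)
    (hK : h ∈ K.map (expand q : MvPolynomial σ R →ₐ[R] MvPolynomial σ R)) (u : σ →₀ ℕ) :
    C (coeff u h) ∈ K := by
  by_cases hu0 : coeff u h = 0
  · rw [hu0, C_0]
    exact zero_mem _
  have hu := lt_of_coeff_ne_zero hdeg hu0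
  suffices hmul : ∀ a, residuePart q u (a * h) ∈ K by
    simpa only [one_mul, residuePart_eq_C hdeg] using hmul 1
  clear hdeg hu0
  refine Submodule.span_induction ?_ ?_ ?_ ?_ hK
  · rintro _ ⟨f, hf, rfl⟩ a
    rw [mul_comm]
    exact residuePart_expand_mul hu f a ▸ Ideal.mul_mem_right _ _ hf
  · intro a
    rw [mul_zero, map_zero]
    exact zero_mem _
  · intro x y _ _ hx hy a
    rw [mul_add, map_add]
    exact add_mem (hx a) (hy a)
  · intro b x _ hx a
    rw [smul_eq_mul, ← mul_assoc]
    exact hx _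

variable {p : ℕ} [ExpChar R p]

theorem pow_expChar_pow_eq_expand_map (e : ℕ) (f : MvPolynomial σ R) :
    f ^ p ^ e = expand (p ^ e) (map (iterateFrobenius R p e) f) := by
  rw [← map_expand, map_iterateFrobenius_expand]

theorem C_coeff_mem_of_mem_map_iterateFrobenius {e : ℕ} {J : Ideal (MvPolynomial σ R)}
    {h : MvPolynomial σ R} (hdeg : ∀ i, h.degreeOf i < p ^ e)
    (hJ : h ∈ J.map (iterateFrobenius (MvPolynomial σ R) p e)) (u : σ →₀ ℕ) :
    C (coeff u h) ∈ J.map (map (iterateFrobenius R p e)) := by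
  have : NeZero (p ^ e) := ⟨pow_ne_zero e (expChar_ne_zero R p)⟩
  have hfrob : iterateFrobenius (MvPolynomial σ R) p e =
      (expand (p ^ e) : MvPolynomial σ R →ₐ[R] _).toRingHom.comp (map (iterateFrobenius R p e)) :=
    RingHom.ext (pow_expChar_pow_eq_expand_map e)
  rw [hfrob, ← Ideal.map_map] at hJ
  exact C_coeff_mem_of_mem_map_expand hdeg hJ u

theorem coeff_add_smul_mul_pow {e : ℕ} {h : MvPolynomial σ R} (hdeg : ∀ i, h.degreeOf i < p ^ e)
    (f : MvPolynomial σ R) {u : σ →₀ ℕ} (hu : ∀ i, u i < p ^ e) (v : σ →₀ ℕ) :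
    coeff (u + p ^ e • v) (h * f ^ p ^ e) = coeff u h * coeff v f ^ p ^ e := by
  have : NeZero (p ^ e) := ⟨pow_ne_zero e (expChar_ne_zero R p)⟩
  rw [← coeff_residuePart, mul_comm, pow_expChar_pow_eq_expand_map, residuePart_expand_mul hu,
    residuePart_eq_C hdeg, mul_comm, coeff_C_mul, coeff_map, iterateFrobenius_def]

/-- The ideal generated by the coefficients of a polynomial in several variables, the analogue of
`Polynomial.contentIdeal`. -/
def coeffIdeal (f : MvPolynomial σ R) : Ideal R :=
  Ideal.span (Set.range fun u ↦ coeff u f)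

theorem coeff_mem_coeffIdeal (f : MvPolynomial σ R) (u : σ →₀ ℕ) : coeff u f ∈ coeffIdeal f :=
  Ideal.subset_span ⟨u, rfl⟩

theorem coeffIdeal_mul_map_le {e : ℕ} {h : MvPolynomial σ R} (hdeg : ∀ i, h.degreeOf i < p ^ e)
    (f : MvPolynomial σ R) :
    coeffIdeal h * (coeffIdeal f).map (iterateFrobenius R p e) ≤ coeffIdeal (h * f ^ p ^ e) := by
  rw [coeffIdeal, coeffIdeal, Ideal.map_span, Ideal.span_mul_span', Ideal.span_le]
  rintro _ ⟨_, ⟨u, rfl⟩, _, ⟨_, ⟨v, rfl⟩, rfl⟩, rfl⟩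
  by_cases hu0 : coeff u h = 0
  · simp only [hu0, zero_mul, SetLike.mem_coe, zero_mem]
  · have hcoeff := coeff_add_smul_mul_pow hdeg f (lt_of_coeff_ne_zero hdeg hu0) v
    simp only [iterateFrobenius_def, ← hcoeff]
    exact coeff_mem_coeffIdeal _ _

end ResiduePart

section FrobeniusPowers

variable {R S : Type*} [CommRing R] [CommRing S]

theorem frobPow_pow_eq_map (p : ℕ) [ExpChar R p] (e : ℕ) (I : Ideal R) :
    frobPow (p ^ e) I = I.map (iterateFrobenius R p e) := by
  rw [frobPow, Ideal.map]
  congr 1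
  ext x
  simp only [Set.mem_ofPred_eq, Set.mem_image, SetLike.mem_coe, iterateFrobenius_def, eq_comm]

theorem map_frobPow_le (f : R →+* S) (q : ℕ) (I : Ideal R) :
    (frobPow q I).map f ≤ frobPow q (I.map f) := by
  rw [frobPow, Ideal.map_span, Ideal.span_le]
  rintro _ ⟨_, ⟨x, hx, rfl⟩, rfl⟩
  exact Ideal.subset_span ⟨f x, Ideal.mem_map_of_mem f hx, map_pow f x q⟩

theorem pow_mem_frobPow {I : Ideal R} {x : R} (hx : x ∈ I) (q : ℕ) : x ^ q ∈ frobPow q I :=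
  Ideal.subset_span ⟨x, hx, rfl⟩

theorem frobRoot_le {q : ℕ} {I J : Ideal R} (h : I ≤ frobPow q J) : frobRoot q I ≤ J :=
  sInf_le h

theorem map_intFrobPow (f : R →+* S) (p : ℕ) [ExpChar R p] [ExpChar S p] (k : ℕ) (I : Ideal R) :
    (intFrobPow p k I).map f = intFrobPow p k (I.map f) := by
  rw [intFrobPow, intFrobPow, ← Ideal.mapHom_apply, map_prod]
  refine Finset.prod_congr rfl fun i _ ↦ ?_
  rw [Ideal.mapHom_apply, frobPow_pow_eq_map, frobPow_pow_eq_map, ← Ideal.map_pow, Ideal.map_map,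
    Ideal.map_map, RingHom.iterateFrobenius_comm]

theorem pow_mod_mem_prod_frobPow {I : Ideal R} {x : R} (hx : x ∈ I) (p k N : ℕ) :
    x ^ (k % p ^ N) ∈ ∏ i ∈ Finset.range N, frobPow (p ^ i) (I ^ (k / p ^ i % p)) := by
  induction N with
  | zero =>
    rw [Finset.prod_range_zero, Ideal.one_eq_top]
    exact Submodule.mem_top
  | succ N ih =>
    rw [Nat.mod_pow_succ, pow_add, Finset.prod_range_succ, mul_comm (p ^ N), pow_mul]
    exact Ideal.mul_mem_mul ih (pow_mem_frobPow (Ideal.pow_mem_pow hx _) _)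

theorem pow_mem_intFrobPow {p : ℕ} (hp : 1 < p) {I : Ideal R} {x : R} (hx : x ∈ I) (k : ℕ) :
    x ^ k ∈ intFrobPow p k I := by
  have h := pow_mod_mem_prod_frobPow hx p k (k + 1)
  rwa [Nat.mod_eq_of_lt ((Nat.lt_succ_self k).trans (Nat.lt_pow_self hp))] at h

theorem intFrobPow_pow_le {p : ℕ} (hp : 1 < p) (e : ℕ) (I : Ideal R) :
    intFrobPow p (p ^ e) I ≤ frobPow (p ^ e) I := by
  have hmem : e ∈ Finset.range (p ^ e + 1) :=
    Finset.mem_range.mpr ((Nat.lt_pow_self hp).trans (Nat.lt_succ_self _))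
  rw [intFrobPow, ← Finset.mul_prod_erase _ _ hmem, Nat.div_self (by positivity),
    Nat.mod_eq_of_lt hp, pow_one]
  exact Ideal.mul_le_left

theorem frobPow_le_intFrobPow {p : ℕ} (hp : 1 < p) {k q : ℕ} (hkq : k ≤ q) (I : Ideal R) :
    frobPow q I ≤ intFrobPow p k I := by
  rw [frobPow, Ideal.span_le]
  rintro _ ⟨x, hx, rfl⟩
  rw [SetLike.mem_coe, ← Nat.sub_add_cancel hkq, pow_add]
  exact Ideal.mul_mem_left _ _ (pow_mem_intFrobPow hp hx k)

theorem ratFrobPow_pow_le {p : ℕ} (hp : 1 < p) (e : ℕ) (I : Ideal R) :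
    ratFrobPow p (p ^ e) e I ≤ I :=
  frobRoot_le (intFrobPow_pow_le hp e I)

theorem iterateFrobenius_faithfullyFlat {p : ℕ} [ExpChar R p] {e : ℕ}
    (hF : (iterateFrobenius R p e).Flat) : (iterateFrobenius R p e).FaithfullyFlat :=
  RingHom.FaithfullyFlat.iff_flat_and_comap_surjective.mpr ⟨hF, fun P ↦
    ⟨P, PrimeSpectrum.ext <| Ideal.ext fun _ ↦
      P.isPrime.pow_mem_iff_mem _ (pow_pos (expChar_pos R p) e)⟩⟩

theorem le_ratFrobPow {p : ℕ} [hp : Fact p.Prime] [CharP R p] {e k : ℕ}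
    (hF : (iterateFrobenius R p e).Flat) (hk : k ≤ p ^ e) (I : Ideal R) :
    I ≤ ratFrobPow p k e I := by
  refine le_sInf fun J hJ ↦
    le_of_map_le_map_of_faithfullyFlat (iterateFrobenius_faithfullyFlat hF) ?_
  rw [← frobPow_pow_eq_map, ← frobPow_pow_eq_map]
  exact (frobPow_le_intFrobPow hp.out.one_lt hk I).trans hJ

theorem ceil_pow_mul_le {p : ℕ} {t : ℝ} (ht : t ≤ 1) (e : ℕ) : ⌈(p : ℝ) ^ e * t⌉₊ ≤ p ^ e := by
  rw [Nat.ceil_le, Nat.cast_pow]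
  exact mul_le_of_le_one_right (by positivity) ht

theorem exists_ceil_pow_mul_lt {p : ℕ} (hp : 1 < p) {t : ℝ} (ht0 : 0 ≤ t) (ht1 : t < 1) :
    ∃ e : ℕ, ⌈(p : ℝ) ^ e * t⌉₊ < p ^ e := by
  obtain ⟨e, he⟩ := pow_unbounded_of_one_lt (1 / (1 - t)) (Nat.one_lt_cast (α := ℝ).mpr hp)
  rw [div_lt_iff₀ (sub_pos.mpr ht1)] at he
  refine ⟨e, Nat.cast_lt (α := ℝ).mp ?_⟩
  calc (⌈(p : ℝ) ^ e * t⌉₊ : ℝ) < (p : ℝ) ^ e * t + 1 := Nat.ceil_lt_add_one (by positivity)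
    _ < (p ^ e : ℕ) := by
      rw [Nat.cast_pow]
      linarith

theorem realFrobPow_eq_iSup_ceil_lt {p : ℕ} [hp : Fact p.Prime] [CharP R p]
    (hF : (frobenius R p).Flat) {t : ℝ} (ht0 : 0 ≤ t) (ht1 : t < 1) (I : Ideal R) :
    realFrobPow p t I =
      ⨆ (e : ℕ) (_ : ⌈(p : ℝ) ^ e * t⌉₊ < p ^ e), ratFrobPow p ⌈(p : ℝ) ^ e * t⌉₊ e I := by
  refine le_antisymm (iSup_le fun e ↦ ?_) (iSup_mono fun e ↦ iSup_le fun _ ↦ le_rfl)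
  rcases (ceil_pow_mul_le ht1.le e).lt_or_eq with hlt | heq
  · exact le_iSup₂_of_le e hlt le_rfl
  · obtain ⟨e', he'⟩ := exists_ceil_pow_mul_lt hp.out.one_lt ht0 ht1
    rw [heq]
    calc ratFrobPow p (p ^ e) e I ≤ I := ratFrobPow_pow_le hp.out.one_lt e I
      _ ≤ ratFrobPow p _ e' I := le_ratFrobPow (iterateFrobenius_flat hF e') he'.le I
      _ ≤ _ := le_iSup₂_of_le e' he' le_rfl

end FrobeniusPowers

section GenericCombination

open MvPolynomial

variable {R : Type*} [CommRing R] {m : ℕ} (g : Fin m → R)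

theorem genericCombination_mem_map_C :
    genericCombination g ∈ (Ideal.span (Set.range g)).map (C : R →+* MvPolynomial (Fin m) R) :=
  sum_mem fun i _ ↦ Ideal.mul_mem_left _ _
    (Ideal.mem_map_of_mem _ (Ideal.subset_span (Set.mem_range_self i)))

theorem isHomogeneous_genericCombination : (genericCombination g).IsHomogeneous 1 :=
  IsHomogeneous.sum _ _ _ fun i _ ↦ mul_comm (C (g i)) (X i) ▸ isHomogeneous_C_mul_X (g i) i

theorem degreeOf_genericCombination_pow_le (k : ℕ) (i : Fin m) :
    (genericCombination g ^ k).degreeOf i ≤ k :=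
  (degreeOf_le_totalDegree _ i).trans
    (((isHomogeneous_genericCombination g).pow k).totalDegree_le.trans_eq (one_mul k))

theorem coeff_genericCombination_pow (u : Fin m →₀ ℕ) (k : ℕ) :
    coeff u (genericCombination g ^ k) =
      if u.sum (fun _ e ↦ e) = k then u.multinomial * u.prod (fun i e ↦ g i ^ e) else 0 := by
  rw [← coeff_linearCombination_X_pow_of_fintype g u k, genericCombination]
  simp only [smul_eq_C_mul, mul_comm]

theorem isUnit_multinomial {p : ℕ} [Fact p.Prime] [CharP R p] {σ : Type*} {u : σ →₀ ℕ}
    (hu : u.sum (fun _ e ↦ e) < p) : IsUnit (u.multinomial : R) :=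
  isUnit_of_dvd_unit (Nat.cast_dvd_cast (Dvd.intro_left _ (Nat.multinomial_spec u.support u)))
    ((IsUnit.natCast_factorial_iff_of_charP p).mpr hu)

theorem span_pow_le_coeffIdeal (p : ℕ) [Fact p.Prime] [CharP R p] {k : ℕ} (hk : k < p) :
    Ideal.span (Set.range g) ^ k ≤ coeffIdeal (genericCombination g ^ k) := by
  intro y hy
  obtain ⟨P, hP, rfl⟩ := (Ideal.mem_span_pow_iff_exists_isHomogeneous g y).mp hy
  rw [eval_eq]
  refine sum_mem fun u hu ↦ Ideal.mul_mem_left _ _ ?_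
  have hdeg : u.sum (fun _ e ↦ e) = k := by
    rw [← hP (mem_support_iff.mp hu), Finsupp.weight_apply]
    simp only [Pi.one_apply, smul_eq_mul, mul_one]
  have hcoeff := coeff_mem_coeffIdeal (genericCombination g ^ k) u
  rw [coeff_genericCombination_pow, if_pos hdeg] at hcoeff
  exact (Ideal.unit_mul_mem_iff_mem _ (isUnit_multinomial (p := p) (hdeg ▸ hk))).mp hcoeff

theorem prod_frobPow_le_coeffIdeal (p : ℕ) [hp : Fact p.Prime] [CharP R p] (k N : ℕ) :
    ∏ i ∈ Finset.range N, frobPow (p ^ i) (Ideal.span (Set.range g) ^ (k / p ^ i % p)) ≤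
      coeffIdeal (genericCombination g ^ (k % p ^ N)) := by
  induction N with
  | zero =>
    rw [pow_zero, Nat.mod_one, pow_zero]
    exact le_top.trans_eq ((Ideal.eq_top_iff_one _).mpr
      (coeff_zero_one (R := R) ▸ coeff_mem_coeffIdeal 1 0)).symm
  | succ N ih =>
    have hdeg (i : Fin m) : (genericCombination g ^ (k % p ^ N)).degreeOf i < p ^ N :=
      (degreeOf_genericCombination_pow_le g _ i).trans_lt (Nat.mod_lt _ (pow_pos hp.out.pos N))
    rw [Nat.mod_pow_succ, pow_add, Finset.prod_range_succ, mul_comm (p ^ N), pow_mul,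
      frobPow_pow_eq_map]
    exact (Ideal.mul_mono ih (Ideal.map_mono (span_pow_le_coeffIdeal g p
      (Nat.mod_lt _ hp.out.pos)))).trans (coeffIdeal_mul_map_le hdeg _)

theorem intFrobPow_le_coeffIdeal (p : ℕ) [hp : Fact p.Prime] [CharP R p] (k : ℕ) :
    intFrobPow p k (Ideal.span (Set.range g)) ≤ coeffIdeal (genericCombination g ^ k) := by
  have h := prod_frobPow_le_coeffIdeal g p k (k + 1)
  rwa [Nat.mod_eq_of_lt ((Nat.lt_succ_self k).trans (Nat.lt_pow_self hp.out.one_lt))] at h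

theorem frobRoot_genericCombination_le (p : ℕ) [hp : Fact p.Prime] [CharP R p] (e k : ℕ) :
    frobRoot (p ^ e) (Ideal.span {genericCombination g} ^ k) ≤
      (ratFrobPow p k e (Ideal.span (Set.range g))).map
        (C : R →+* MvPolynomial (Fin m) R) := by
  intro f hf
  rw [mem_map_C_iff]
  intro u
  rw [ratFrobPow, frobRoot, Submodule.mem_sInf]
  intro c hc
  refine mem_map_C_iff.mp (frobRoot_le ?_ hf) u
  rw [Ideal.span_singleton_pow, Ideal.span_singleton_le_iff_mem]
  refine map_frobPow_le C _ _ (Ideal.map_mono hc ?_)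
  rw [map_intFrobPow]
  exact pow_mem_intFrobPow hp.out.one_lt (genericCombination_mem_map_C g) k

theorem map_ratFrobPow_le {p : ℕ} [hp : Fact p.Prime] [CharP R p] {e k : ℕ}
    (hF : (iterateFrobenius R p e).Flat) (hk : k < p ^ e) :
    (ratFrobPow p k e (Ideal.span (Set.range g))).map (C : R →+* MvPolynomial (Fin m) R) ≤
      frobRoot (p ^ e) (Ideal.span {genericCombination g} ^ k) := by
  refine le_sInf fun J hJ ↦ Ideal.map_le_iff_le_comap.mpr (frobRoot_le ?_)
  rw [Set.mem_ofPred_eq, Ideal.span_singleton_pow, Ideal.span_singleton_le_iff_mem,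
    frobPow_pow_eq_map] at hJ
  rw [frobPow_pow_eq_map]
  refine (intFrobPow_le_coeffIdeal g p k).trans (Ideal.span_le.mpr ?_)
  rintro _ ⟨u, rfl⟩
  exact comap_C_map_map_le_of_flat hF J (C_coeff_mem_of_mem_map_iterateFrobenius
    (fun i ↦ (degreeOf_genericCombination_pow_le g k i).trans_lt hk) hJ u)

theorem testIdeal_genericCombination {p : ℕ} [Fact p.Prime] [CharP R p]
    (hF : (frobenius R p).Flat) {t : ℝ} (ht0 : 0 ≤ t) (ht1 : t < 1) :
    testIdeal p t (Ideal.span {genericCombination g}) =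
      (realFrobPow p t (Ideal.span (Set.range g))).map (C : R →+* MvPolynomial (Fin m) R) := by
  apply le_antisymm
  · rw [realFrobPow, Ideal.map_iSup]
    exact iSup_mono fun e ↦ frobRoot_genericCombination_le g p e _
  · rw [realFrobPow_eq_iSup_ceil_lt hF ht0 ht1, Ideal.map_le_iff_le_comap]
    exact iSup₂_le fun e he ↦ Ideal.map_le_iff_le_comap.mp <|
      (map_ratFrobPow_le g (iterateFrobenius_flat hF e) he).trans
        (le_iSup (fun e ↦ frobRoot (p ^ e) (_ ^ ⌈(p : ℝ) ^ e * t⌉₊)) e)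

end GenericCombination

end GenFrob

theorem mainTheorem1_general {R : Type*} [CommRing R] (p : ℕ) [Fact p.Prime] [CharP R p]
    (hF : (frobenius R p).Flat) {m : ℕ} (g : Fin m → R) {t : ℝ} (ht0 : 0 ≤ t) (ht1 : t < 1) :
    GenFrob.testIdeal p t (Ideal.span {GenFrob.genericCombination g}) =
        Ideal.map (MvPolynomial.C : R →+* MvPolynomial (Fin m) R)
          (GenFrob.realFrobPow p t (Ideal.span (Set.range g))) ∧
      GenFrob.realFrobPow p t (Ideal.span (Set.range g)) =
        Ideal.comap (MvPolynomial.C : R →+* MvPolynomial (Fin m) R)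
          (GenFrob.testIdeal p t (Ideal.span {GenFrob.genericCombination g})) := by
  have : Nontrivial R := CharP.nontrivial_of_char_ne_one (Fact.out : p.Prime).ne_one
  have htest := GenFrob.testIdeal_genericCombination g hF ht0 ht1
  refine ⟨htest, ?_⟩
  rw [htest]
  exact (Ideal.comap_map_eq_self_of_faithfullyFlat (B := MvPolynomial (Fin m) R) _).symm

theorem mainTheorem1 {R : Type*} [CommRing R] [IsDomain R] [IsRegularRing R]
    (p : ℕ) [Fact p.Prime] [CharP R p] (hF : (frobenius R p).Finite)
    (m : ℕ) (g : Fin m → R) (a : Ideal R) (ha : a = Ideal.span (Set.range g))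
    (t : ℝ) (ht0 : 0 < t) (ht1 : t < 1) :
    GenFrob.testIdeal p t (Ideal.span {GenFrob.genericCombination g}) =
        Ideal.map (MvPolynomial.C : R →+* MvPolynomial (Fin m) R) (GenFrob.realFrobPow p t a) ∧
      GenFrob.realFrobPow p t a =
        Ideal.comap (MvPolynomial.C : R →+* MvPolynomial (Fin m) R)
          (GenFrob.testIdeal p t (Ideal.span {GenFrob.genericCombination g})) := by
  subst ha
  exact mainTheorem1_general p (GenFrob.frobenius_flat_of_isRegularRing R p hF) g ht0.le ht1
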